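/- **Setting.** A *scalar field* is a pair $(\mathbb X,f)$ of a topological space $\mathbb X$ and a continuous function $f:\mathbb X\to\mathbb R$; a *function preserving map* $(\mathbb X,f)\to(\mathbb Y,g)$ is a continuous map $\alpha$ with $g\circ\alpha=f$. The *Reeb graph* $\mathcal R_f$ is the quotient space of $\mathbb X$ that identifies $x$ and $y$ when $f(x)=f(y)=a$ and $x,y$ lie in the same connected component of $f^{-1}(a)$, with the induced function $\tilde f$. For $\varepsilon\ge 0$ the *smoothing* $S_\varepsilon(\mathbb X,f)$ is the Reeb graph of $(\mathbb X\times[-\varepsilon,\varepsilon],\ (x,t)\mapsto f(x)+t)$; write $[x,t]$ for the class of $(x,t)$. For $\tau\ge 0$ the *truncation* $T^\tau(\mathbb X,f)$ is the subspace of those points from which there start both a path along which $f$ is non-decreasing and increases by $\tau$ in total and a path along which $f$ is non-increasing and decreases by $\tau$ in total. Put $S_\varepsilon^\tau=T^\tau S_\varepsilon$. A function preserving map $\alpha$ induces $S^\tau_\varepsilon[\alpha]:[x,t]\mapsto[\alpha(x),t]$. There are maps $\eta:\mathbb X\to S_\varepsilon^\tau(\mathbb X)$, $x\mapsto[x,0]$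 (for $\tau\le\varepsilon$), and $\eta:S_\varepsilon^\tau(\mathbb X)\to S_{\varepsilon'}^{\tau'}(\mathbb X)$, $[x,t]\mapsto[x,t]$ (for $0\le\tau'-\tau\le\varepsilon'-\varepsilon$), and a canonical map $S_\varepsilon^\tau(S_\varepsilon^\tau(\mathbb X))\to S_{2\varepsilon}^{2\tau}(\mathbb X)$, $[[x,s],t]\mapsto[x,s+t]$. For $m\in[0,1]$ and $\varepsilon\ge0$, an *$\varepsilon$-interleaving* (with respect to $S_\varepsilon^{m\varepsilon}$) of $\mathcal R_f$ and $\mathcal R_g$ is a pair of function preserving maps $\phi:\mathcal R_f\to S_\varepsilon^{m\varepsilon}(\mathcal R_g)$, $\psi:\mathcal R_g\to S_\varepsilon^{m\varepsilon}(\mathcal R_f)$ with $$S_\varepsilon^{m\varepsilon}[\psi]\circ\phi=\eta\circ\eta,\qquad S_\varepsilon^{m\varepsilon}[\phi]\circ\psi=\eta\circ\eta,\qquad S_\varepsilon^{m\varepsilon}[\phi]\circ\eta=\eta\circ\phi,\qquad S_\varepsilon^{m\varepsilon}[\psi]\circ\eta=\eta\circ\psi,$$ where $S_\varepsilon^{m\varepsilon}[\phi]$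 and $S_\varepsilon^{m\varepsilon}[\psi]$ are regarded as maps into $S_{2\varepsilon}^{2m\varepsilon}(\mathcal R_g)$ and $S_{2\varepsilon}^{2m\varepsilon}(\mathcal R_f)$ through the canonical map. The *truncated interleaving distance* is $$d_I^m(\mathcal R_f,\mathcal R_g)=\inf\{\varepsilon\ge 0:\ \mathcal R_f\text{ and }\mathcal R_g\text{ are }\varepsilon\text{-interleaved}\}\in[0,\infty],\qquad \inf\emptyset=\infty .$$ **Corollary.** For all $0\le M\le M'<1$ the distances $d_I^M$ and $d_I^{M'}$ on Reeb graphs are strongly equivalent (each is bounded by a positive constant times the other, uniformly over all pairs of Reeb graphs). Specifically, for the Reeb graphs $\mathcal R_f,\mathcal R_g$ of any two scalar fields, $$d_I^M(\mathcal R_f,\mathcal R_g)\ \le\ d_I^{M'}(\mathcal R_f,\mathcal R_g)\ \le\ \frac{1-M}{1-M'}\,d_I^M(\mathcal R_f,\mathcal R_g).$$ -/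

import Mathlib

open scoped NNReal ENNReal unitInterval

universe u

/-- A scalar field (`ℝ`-space): a topological space with a continuous real-valued function. -/
structure ScalarField : Type (u + 1) where
  carrier : Type u
  [top : TopologicalSpace carrier]
  f : carrier → ℝ
  continuous_f : Continuous f

namespace ScalarField

instance : CoeSort ScalarField.{u} (Type u) := ⟨ScalarField.carrier⟩

instance (X : ScalarField.{u}) : TopologicalSpace X := X.top

/-- Function preserving maps: continuous maps `φ : X → Y` with `f_Y ∘ φ = f_X`. -/
@[ext]
structure Hom (X Y : ScalarField.{u}) where
  toFun : X → Y
  continuous_toFun : Continuous toFun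
  f_toFun : ∀ x, Y.f (toFun x) = X.f x

instance (X Y : ScalarField.{u}) : CoeFun (Hom X Y) (fun _ => X → Y) := ⟨Hom.toFun⟩

/-- Composition of function preserving maps: `φ.comp ψ` is `φ ∘ ψ`. -/
def Hom.comp {X Y Z : ScalarField.{u}} (φ : Hom Y Z) (ψ : Hom X Y) : Hom X Z where
  toFun x := φ (ψ x)
  continuous_toFun := φ.continuous_toFun.comp ψ.continuous_toFun
  f_toFun x := by rw [φ.f_toFun, ψ.f_toFun]

/-! ### Reeb graphs -/

/-- `x ∼ y` if `f x = f y = a` and `x`, `y` lie in the same connected component of the level set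
`f ⁻¹ {a}`. -/
def reebSetoid (X : ScalarField.{u}) : Setoid X where
  r x y := X.f x = X.f y ∧ y ∈ connectedComponentIn (X.f ⁻¹' {X.f x}) x
  iseqv :=
    { refl := fun x => ⟨rfl, mem_connectedComponentIn rfl⟩
      symm := by
        rintro x y ⟨h, hy⟩
        refine ⟨h.symm, ?_⟩
        rw [← h, ← connectedComponentIn_eq hy]
        exact mem_connectedComponentIn rfl
      trans := by
        rintro x y z ⟨h, hy⟩ ⟨h', hz⟩
        refine ⟨h.trans h', ?_⟩
        rw [connectedComponentIn_eq hy, h]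
        exact hz }

/-- The Reeb graph of a scalar field: the quotient space by `reebSetoid`, with the induced
function. -/
def reeb (X : ScalarField.{u}) : ScalarField.{u} where
  carrier := Quotient X.reebSetoid
  top := inferInstanceAs (TopologicalSpace (Quotient X.reebSetoid))
  f := Quotient.lift X.f (fun _ _ h => h.1)
  continuous_f := X.continuous_f.quotient_lift _

/-- The quotient map from a scalar field to its Reeb graph. -/
def toReeb (X : ScalarField.{u}) : Hom X X.reeb where
  toFun := Quotient.mk X.reebSetoid
  continuous_toFun := continuous_quotient_mk'
  f_toFun _ := rfl

theorem isQuotientMap_toReeb (X : ScalarField.{u}) : Topology.IsQuotientMap X.toReeb.toFun :=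
  isQuotientMap_quotient_mk'

theorem reebSetoid_of_continuous {X Y : ScalarField.{u}} {g : X → Y} (hg : Continuous g) {c : ℝ}
    (hc : ∀ x, Y.f (g x) = X.f x + c) {x y : X} (h : X.reebSetoid x y) :
    Y.reebSetoid (g x) (g y) := by
  refine ⟨by rw [hc, hc, h.1], ?_⟩
  have h1 := hg.continuousOn.mapsTo_connectedComponentIn
    (s := X.f ⁻¹' {X.f x}) (a := x) rfl h.2
  refine connectedComponentIn_mono _ ?_ h1
  rintro _ ⟨z, hz, rfl⟩
  have hz' : X.f z = X.f x := hz
  change Y.f (g z) = Y.f (g x)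
  rw [hc, hc, hz']

theorem reebSetoid_map {X Y : ScalarField.{u}} (φ : Hom X Y) {x y : X}
    (h : X.reebSetoid x y) : Y.reebSetoid (φ x) (φ y) :=
  reebSetoid_of_continuous φ.continuous_toFun (c := 0) (fun x => by rw [φ.f_toFun, add_zero]) h

theorem toReeb_eq_iff {X : ScalarField.{u}} {x y : X} :
    X.toReeb x = X.toReeb y ↔ X.reebSetoid x y :=
  ⟨fun h => Quotient.exact h, fun h => Quotient.sound h⟩

/-- Levelset components of a Reeb graph are single points. -/
theorem eq_of_reebSetoid_reeb {X : ScalarField.{u}} {p q : X.reeb}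
    (h : X.reeb.reebSetoid p q) : p = q := by
  obtain ⟨x, rfl⟩ := X.isQuotientMap_toReeb.surjective p
  obtain ⟨y, rfl⟩ := X.isQuotientMap_toReeb.surjective q
  obtain ⟨hxy, hy⟩ := h
  set L : Set X.reeb := X.reeb.f ⁻¹' {X.reeb.f (X.toReeb x)} with hL
  have hLc : IsClosed L := isClosed_singleton.preimage X.reeb.continuous_f
  set C : Set X.reeb := closure (connectedComponentIn L (X.toReeb x)) with hC
  have hCL : C ⊆ L := closure_minimal (connectedComponentIn_subset _ _) hLc
  have hx : X.toReeb x ∈ connectedComponentIn L (X.toReeb x) := mem_connectedComponentIn rfl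
  have hCc : IsConnected C := IsConnected.closure
    (isConnected_connectedComponentIn_iff.2 (show X.toReeb x ∈ L from rfl))
  have hfib : ∀ r : X.reeb, IsConnected (X.toReeb.toFun ⁻¹' {r}) := by
    intro r
    obtain ⟨z, rfl⟩ := X.isQuotientMap_toReeb.surjective r
    have : X.toReeb.toFun ⁻¹' {X.toReeb.toFun z}
        = connectedComponentIn (X.f ⁻¹' {X.f z}) z := by
      ext w
      change X.toReeb w = X.toReeb z ↔ _
      rw [eq_comm, toReeb_eq_iff]
      exact ⟨fun h => h.2, fun h => ⟨(connectedComponentIn_subset _ _ h).symm, h⟩⟩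
    rw [this]
    exact isConnected_connectedComponentIn_iff.2 rfl
  have hpre : IsConnected (X.toReeb.toFun ⁻¹' C) :=
    X.isQuotientMap_toReeb.isCoinducing.isConnected_preimage_of_isClosed hfib isClosed_closure hCc
  refine toReeb_eq_iff.2 ⟨hxy, ?_⟩
  refine hpre.isPreconnected.subset_connectedComponentIn (subset_closure hx) ?_
    (subset_closure hy)
  exact fun z hz => hCL hz

/-- A function preserving map into a Reeb graph descends to the Reeb graph of the source. -/
def reebLift {X Y : ScalarField.{u}} (φ : Hom X Y.reeb) : Hom X.reeb Y.reeb where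
  toFun := Quotient.lift φ.toFun (fun _ _ h => eq_of_reebSetoid_reeb (reebSetoid_map φ h))
  continuous_toFun := φ.continuous_toFun.quotient_lift _
  f_toFun := by rintro ⟨x⟩; exact φ.f_toFun x

/-- The Reeb functor on morphisms. -/
def reebMap {X Y : ScalarField.{u}} (φ : Hom X Y) : Hom X.reeb Y.reeb :=
  reebLift (Y.toReeb.comp φ)

/-! ### Thickening and smoothing -/

/-- The thickening `(X × [-ε, ε], (x, t) ↦ f x + t)`. -/
def thicken (ε : ℝ≥0) (X : ScalarField.{u}) : ScalarField.{u} where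
  carrier := X × Set.Icc (-(ε : ℝ)) ε
  f p := X.f p.1 + p.2
  continuous_f := by
    have := X.continuous_f
    fun_prop

/-- The thickening functor on morphisms, `(x, t) ↦ (φ x, t)`. -/
def thickenMap (ε : ℝ≥0) {X Y : ScalarField.{u}} (φ : Hom X Y) :
    Hom (X.thicken ε) (Y.thicken ε) where
  toFun p := (φ p.1, p.2)
  continuous_toFun := by
    have := φ.continuous_toFun
    exact (this.comp continuous_fst).prodMk continuous_snd
  f_toFun p := by
    change Y.f (φ p.1) + _ = X.f p.1 + _
    rw [φ.f_toFun]

/-- The smoothing `S_ε(X)`: the Reeb graph of the thickening. -/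
def smooth (ε : ℝ≥0) (X : ScalarField.{u}) : ScalarField.{u} := (X.thicken ε).reeb

/-- The quotient map `(x, t) ↦ [x, t]` from the thickening to the smoothing. -/
def smoothMk (ε : ℝ≥0) (X : ScalarField.{u}) : Hom (X.thicken ε) (X.smooth ε) :=
  (X.thicken ε).toReeb

theorem isQuotientMap_smoothMk (ε : ℝ≥0) (X : ScalarField.{u}) :
    Topology.IsQuotientMap (X.smoothMk ε).toFun :=
  (X.thicken ε).isQuotientMap_toReeb

theorem smooth_ind {ε : ℝ≥0} {X : ScalarField.{u}} {P : X.smooth ε → Prop}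
    (h : ∀ (x : X) (t : Set.Icc (-(ε : ℝ)) ε), P (X.smoothMk ε (x, t))) (p : X.smooth ε) : P p := by
  obtain ⟨⟨x, t⟩, rfl⟩ := (X.isQuotientMap_smoothMk ε).surjective p
  exact h x t

/-- The smoothing functor on morphisms, `[x, t] ↦ [φ x, t]`. -/
def smoothMap (ε : ℝ≥0) {X Y : ScalarField.{u}} (φ : Hom X Y) : Hom (X.smooth ε) (Y.smooth ε) :=
  reebMap (thickenMap ε φ)

/-- The natural map `X → S_ε(X)`, `x ↦ [x, 0]`. -/
def toSmooth (ε : ℝ≥0) (X : ScalarField.{u}) : Hom X (X.smooth ε) where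
  toFun x := X.smoothMk ε (x, ⟨0, by simp, by simp⟩)
  continuous_toFun :=
    (X.smoothMk ε).continuous_toFun.comp (continuous_id.prodMk continuous_const)
  f_toFun x := add_zero (X.f x)

/-- For `ε ≤ ε'`, the inclusion of thickenings `(x, t) ↦ (x, t)`. -/
def thickenIncl {ε ε' : ℝ≥0} (h : ε ≤ ε') (X : ScalarField.{u}) :
    Hom (X.thicken ε) (X.thicken ε') where
  toFun p := (p.1, ⟨p.2.1, (neg_le_neg (NNReal.coe_le_coe.2 h)).trans p.2.2.1,
    p.2.2.2.trans (NNReal.coe_le_coe.2 h)⟩)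
  continuous_toFun :=
    continuous_fst.prodMk (Continuous.subtype_mk (continuous_subtype_val.comp continuous_snd) _)
  f_toFun _ := rfl

/-- For `ε ≤ ε'`, the natural map `S_ε(X) → S_ε'(X)`, `[x, t] ↦ [x, t]`. -/
def smoothIncl {ε ε' : ℝ≥0} (h : ε ≤ ε') (X : ScalarField.{u}) :
    Hom (X.smooth ε) (X.smooth ε') :=
  reebMap (thickenIncl h X)

/-- For fixed `t ∈ [-ε, ε]`, the map `(x, s) ↦ (x, s + t)` of thickenings. -/
def thickenShift {ε ε' : ℝ≥0} (X : ScalarField.{u}) (p : X.thicken ε')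
    (t : Set.Icc (-(ε : ℝ)) ε) : X.thicken (ε + ε') :=
  (p.1, ⟨p.2.1 + t.1, by
    have h1 := p.2.2.1; have h2 := t.2.1
    push_cast; linarith, by
    have h1 := p.2.2.2; have h2 := t.2.2
    push_cast; linarith⟩)

theorem continuous_thickenShift {ε ε' : ℝ≥0} (X : ScalarField.{u}) :
    Continuous (fun q : X.thicken ε' × Set.Icc (-(ε : ℝ)) ε => X.thickenShift q.1 q.2) := by
  refine (continuous_fst.comp continuous_fst).prodMk (Continuous.subtype_mk ?_ _)
  exact (continuous_subtype_val.comp (continuous_snd.comp continuous_fst)).add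
    (continuous_subtype_val.comp continuous_snd)

theorem f_thickenShift {ε ε' : ℝ≥0} (X : ScalarField.{u}) (p : X.thicken ε')
    (t : Set.Icc (-(ε : ℝ)) ε) :
    (X.thicken (ε + ε')).f (X.thickenShift p t) = (X.thicken ε').f p + t :=
  (add_assoc _ _ _).symm

theorem reebSetoid_thickenShift {ε ε' : ℝ≥0} (X : ScalarField.{u}) (t : Set.Icc (-(ε : ℝ)) ε)
    {p q : X.thicken ε'} (h : (X.thicken ε').reebSetoid p q) :
    (X.thicken (ε + ε')).reebSetoid (X.thickenShift p t) (X.thickenShift q t) :=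
  reebSetoid_of_continuous (g := fun p : X.thicken ε' => X.thickenShift p t)
    (X.continuous_thickenShift.comp (continuous_id.prodMk continuous_const))
    (fun p => X.f_thickenShift p t) h

/-- The map `([x, s], t) ↦ [x, s + t]` from the thickening of `S_ε'(X)` to `S_{ε + ε'}(X)`. -/
def thickenSmooth (ε ε' : ℝ≥0) (X : ScalarField.{u}) :
    Hom ((X.smooth ε').thicken ε) (X.smooth (ε + ε')) where
  toFun q := Quotient.lift
    (fun p : X.thicken ε' => X.smoothMk (ε + ε') (X.thickenShift p q.2))
    (fun _ _ h => Quotient.sound (X.reebSetoid_thickenShift q.2 h)) q.1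
  continuous_toFun :=
    (X.isQuotientMap_smoothMk ε').continuous_lift_prod_left
      ((X.smoothMk (ε + ε')).continuous_toFun.comp X.continuous_thickenShift)
  f_toFun := by
    rintro ⟨⟨p⟩, t⟩
    exact X.f_thickenShift p t

/-- The canonical map `S_ε(S_ε'(X)) → S_{ε + ε'}(X)`, `[[x, s], t] ↦ [x, s + t]`. -/
def smoothSmooth (ε ε' : ℝ≥0) (X : ScalarField.{u}) :
    Hom ((X.smooth ε').smooth ε) (X.smooth (ε + ε')) :=
  reebLift (thickenSmooth ε ε' X)

/-! ### Up-paths, down-paths and truncation -/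

/-- `x` has an up-path of height `τ`: a path starting at `x` along which `f` is monotone
increasing, and along which `f` increases by `τ` in total. -/
def HasUpPath (X : ScalarField.{u}) (τ : ℝ≥0) (x : X) : Prop :=
  ∃ (y : X) (γ : Path x y), Monotone (fun t => X.f (γ t)) ∧ X.f y = X.f x + τ

/-- `x` has a down-path of height `τ`. -/
def HasDownPath (X : ScalarField.{u}) (τ : ℝ≥0) (x : X) : Prop :=
  ∃ (y : X) (γ : Path x y), Antitone (fun t => X.f (γ t)) ∧ X.f y = X.f x - τ

theorem HasUpPath.map {X Y : ScalarField.{u}} (φ : Hom X Y) {τ : ℝ≥0} {x : X}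
    (h : X.HasUpPath τ x) : Y.HasUpPath τ (φ x) := by
  obtain ⟨y, γ, h1, h2⟩ := h
  refine ⟨φ y, γ.map φ.continuous_toFun, fun s t hst => ?_, by rw [φ.f_toFun, φ.f_toFun, h2]⟩
  change Y.f (φ (γ s)) ≤ Y.f (φ (γ t))
  rw [φ.f_toFun, φ.f_toFun]
  exact h1 hst

theorem HasDownPath.map {X Y : ScalarField.{u}} (φ : Hom X Y) {τ : ℝ≥0} {x : X}
    (h : X.HasDownPath τ x) : Y.HasDownPath τ (φ x) := by
  obtain ⟨y, γ, h1, h2⟩ := h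
  refine ⟨φ y, γ.map φ.continuous_toFun, fun s t hst => ?_, by rw [φ.f_toFun, φ.f_toFun, h2]⟩
  change Y.f (φ (γ t)) ≤ Y.f (φ (γ s))
  rw [φ.f_toFun, φ.f_toFun]
  exact h1 hst

theorem monotone_trans {Z : Type*} [TopologicalSpace Z] {g : Z → ℝ} {x y z : Z} (γ : Path x y)
    (δ : Path y z) (hγ : Monotone (fun t => g (γ t))) (hδ : Monotone (fun t => g (δ t))) :
    Monotone (fun t => g (γ.trans δ t)) := by
  intro s t hst
  have hst' : (s : ℝ) ≤ t := hst
  simp only [Path.trans_apply]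
  split_ifs with hs ht ht
  · exact hγ (Subtype.mk_le_mk.2 (by linarith))
  · have h1 := hγ (unitInterval.le_one' (t := ⟨2 * (s : ℝ),
      (unitInterval.mul_pos_mem_iff zero_lt_two).2 ⟨s.2.1, hs⟩⟩))
    have h2 := hδ (unitInterval.nonneg' (t := ⟨2 * (t : ℝ) - 1,
      unitInterval.two_mul_sub_one_mem_iff.2 ⟨(not_le.1 ht).le, t.2.2⟩⟩))
    simp only [Path.target, Path.source] at h1 h2
    exact h1.trans h2
  · exact absurd (hst'.trans ht) hs
  · exact hδ (Subtype.mk_le_mk.2 (by linarith))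

theorem HasUpPath.map_append {X Y : ScalarField.{u}} (φ : Hom X Y) {a b : ℝ≥0} {x : X}
    (h : X.HasUpPath a x) (hb : ∀ y, Y.HasUpPath b (φ y)) : Y.HasUpPath (a + b) (φ x) := by
  obtain ⟨y, γ, h1, h2⟩ := h
  obtain ⟨z, δ, h3, h4⟩ := hb y
  refine ⟨z, (γ.map φ.continuous_toFun).trans δ, monotone_trans _ _ (fun s t hst => ?_) h3, ?_⟩
  · change Y.f (φ (γ s)) ≤ Y.f (φ (γ t))
    rw [φ.f_toFun, φ.f_toFun]
    exact h1 hst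
  · rw [h4, φ.f_toFun, φ.f_toFun, h2]; push_cast; ring

theorem HasDownPath.map_append {X Y : ScalarField.{u}} (φ : Hom X Y) {a b : ℝ≥0} {x : X}
    (h : X.HasDownPath a x) (hb : ∀ y, Y.HasDownPath b (φ y)) : Y.HasDownPath (a + b) (φ x) := by
  obtain ⟨y, γ, h1, h2⟩ := h
  obtain ⟨z, δ, h3, h4⟩ := hb y
  have := monotone_trans (g := fun w => -Y.f w) (γ.map φ.continuous_toFun) δ
    (fun s t hst => by
      change -Y.f (φ (γ s)) ≤ -Y.f (φ (γ t))
      rw [φ.f_toFun, φ.f_toFun]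
      exact neg_le_neg (h1 hst)) h3.neg
  refine ⟨z, (γ.map φ.continuous_toFun).trans δ, by simpa using this.neg, ?_⟩
  rw [h4, φ.f_toFun, φ.f_toFun, h2]; push_cast; ring

theorem hasUpPath_smoothMk {X : ScalarField.{u}} {ε δ : ℝ≥0} (x : X) (t : Set.Icc (-(ε : ℝ)) ε)
    (h : (t : ℝ) + δ ≤ ε) : (X.smooth ε).HasUpPath δ (X.smoothMk ε (x, t)) := by
  have hb : ∀ r : I, (t : ℝ) + r * δ ∈ Set.Icc (-(ε : ℝ)) ε := fun r =>
    ⟨by have := t.2.1; have := mul_nonneg r.2.1 δ.coe_nonneg; linarith,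
     by have := mul_le_mul_of_nonneg_right r.2.2 δ.coe_nonneg; linarith⟩
  let g : I → X.thicken ε := fun r => (x, ⟨t + r * δ, hb r⟩)
  have hg : Continuous g := continuous_const.prodMk (Continuous.subtype_mk (by fun_prop) _)
  refine ⟨X.smoothMk ε (g 1), ⟨⟨fun r => X.smoothMk ε (g r),
    (X.smoothMk ε).continuous_toFun.comp hg⟩, ?_, rfl⟩, ?_, ?_⟩
  · have : g 0 = (x, t) := Prod.ext rfl (Subtype.ext (by simp [g]))
    change X.smoothMk ε (g 0) = _
    rw [this]
  · intro r s hrs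
    change X.f x + (t + r * δ) ≤ X.f x + (t + s * δ)
    have := mul_le_mul_of_nonneg_right (show (r : ℝ) ≤ s from hrs) δ.coe_nonneg
    linarith
  · change X.f x + (t + (1 : I) * δ) = X.f x + t + δ
    simp; ring

theorem hasDownPath_smoothMk {X : ScalarField.{u}} {ε δ : ℝ≥0} (x : X)
    (t : Set.Icc (-(ε : ℝ)) ε) (h : -(ε : ℝ) ≤ t - δ) :
    (X.smooth ε).HasDownPath δ (X.smoothMk ε (x, t)) := by
  have hb : ∀ r : I, (t : ℝ) - r * δ ∈ Set.Icc (-(ε : ℝ)) ε := fun r =>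
    ⟨by have := mul_le_mul_of_nonneg_right r.2.2 δ.coe_nonneg; linarith,
     by have := t.2.2; have := mul_nonneg r.2.1 δ.coe_nonneg; linarith⟩
  let g : I → X.thicken ε := fun r => (x, ⟨t - r * δ, hb r⟩)
  have hg : Continuous g := continuous_const.prodMk (Continuous.subtype_mk (by fun_prop) _)
  refine ⟨X.smoothMk ε (g 1), ⟨⟨fun r => X.smoothMk ε (g r),
    (X.smoothMk ε).continuous_toFun.comp hg⟩, ?_, rfl⟩, ?_, ?_⟩
  · have : g 0 = (x, t) := Prod.ext rfl (Subtype.ext (by simp [g]))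
    change X.smoothMk ε (g 0) = _
    rw [this]
  · intro r s hrs
    change X.f x + (t - s * δ) ≤ X.f x + (t - r * δ)
    have := mul_le_mul_of_nonneg_right (show (r : ℝ) ≤ s from hrs) δ.coe_nonneg
    linarith
  · change X.f x + (t - (1 : I) * δ) = X.f x + t - δ
    simp; ring

/-- The truncation `T^τ(X)`: remove all points that have no up-path of height `τ` and all points
that have no down-path of height `τ`. -/
def truncate (τ : ℝ≥0) (X : ScalarField.{u}) : ScalarField.{u} where
  carrier := {x : X // X.HasUpPath τ x ∧ X.HasDownPath τ x}
  f x := X.f x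
  continuous_f := X.continuous_f.comp continuous_subtype_val

/-- The inclusion `T^τ(X) → X`. -/
def truncateIncl (τ : ℝ≥0) (X : ScalarField.{u}) : Hom (X.truncate τ) X where
  toFun x := x.1
  continuous_toFun := continuous_subtype_val
  f_toFun _ := rfl

/-- Restriction of the codomain of a function preserving map to the truncation. -/
def Hom.codTruncate {X Y : ScalarField.{u}} (τ : ℝ≥0) (φ : Hom X Y)
    (h : ∀ x, Y.HasUpPath τ (φ x) ∧ Y.HasDownPath τ (φ x)) : Hom X (Y.truncate τ) where
  toFun x := ⟨φ x, h x⟩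
  continuous_toFun := φ.continuous_toFun.subtype_mk _
  f_toFun := φ.f_toFun

/-- The truncation functor on morphisms. -/
def truncateMap (τ : ℝ≥0) {X Y : ScalarField.{u}} (φ : Hom X Y) :
    Hom (X.truncate τ) (Y.truncate τ) :=
  (φ.comp (X.truncateIncl τ)).codTruncate τ (fun x => ⟨x.2.1.map φ, x.2.2.map φ⟩)

/-! ### Truncated smoothing -/

/-- The truncated smoothing `S_ε^τ(X) = T^τ(S_ε(X))`. -/
def truncSmooth (ε τ : ℝ≥0) (X : ScalarField.{u}) : ScalarField.{u} := (X.smooth ε).truncate τ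

/-- The truncated smoothing functor on morphisms, `[x, t] ↦ [φ x, t]`. -/
def truncSmoothMap (ε τ : ℝ≥0) {X Y : ScalarField.{u}} (φ : Hom X Y) :
    Hom (X.truncSmooth ε τ) (Y.truncSmooth ε τ) :=
  truncateMap τ (smoothMap ε φ)

/-- For `τ ≤ ε`, the map `η : X → S_ε^τ(X)`, `x ↦ [x, 0]`. -/
def eta₀ {ε τ : ℝ≥0} (h : τ ≤ ε) (X : ScalarField.{u}) : Hom X (X.truncSmooth ε τ) :=
  (X.toSmooth ε).codTruncate τ (fun x => by
    have h' : (τ : ℝ) ≤ ε := h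
    exact ⟨hasUpPath_smoothMk x _ (by simpa using h'), hasDownPath_smoothMk x _ (by simpa using h')⟩)

/-- For `0 ≤ τ' - τ ≤ ε' - ε`, the map `η : S_ε^τ(X) → S_ε'^τ'(X)`, `[x, t] ↦ [x, t]`. -/
def eta {ε ε' τ τ' : ℝ≥0} (hτ : τ ≤ τ') (h : ε + τ' ≤ ε' + τ) (X : ScalarField.{u}) :
    Hom (X.truncSmooth ε τ) (X.truncSmooth ε' τ') :=
  have hε : ε ≤ ε' := le_of_add_le_add_right ((add_le_add_right hτ ε).trans h)
  ((X.smoothIncl hε).comp ((X.smooth ε).truncateIncl τ)).codTruncate τ' (by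
    have h' : (ε : ℝ) + τ' ≤ ε' + τ := by exact_mod_cast h
    have hd : τ + (τ' - τ) = τ' := add_tsub_cancel_of_le hτ
    have hd' : ((τ' - τ : ℝ≥0) : ℝ) = τ' - τ := NNReal.coe_sub hτ
    rintro ⟨p, hp, hp'⟩
    rw [← hd]
    exact ⟨hp.map_append (X.smoothIncl hε) (smooth_ind fun x t =>
        hasUpPath_smoothMk x _ (by rw [hd']; have := t.2.2; change (t : ℝ) + _ ≤ _; linarith)),
      hp'.map_append (X.smoothIncl hε) (smooth_ind fun x t =>
        hasDownPath_smoothMk x _ (by rw [hd']; have := t.2.1; change _ ≤ (t : ℝ) - _; linarith))⟩)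

theorem hasUpPath_thickenSmooth {ε ε' τ : ℝ≥0} {X : ScalarField.{u}} (p : X.smooth ε')
    (t : Set.Icc (-(ε : ℝ)) ε) (h : (X.smooth ε').HasUpPath τ p) :
    (X.smooth (ε + ε')).HasUpPath τ (thickenSmooth ε ε' X (p, t)) := by
  obtain ⟨y, γ, h1, h2⟩ := h
  have hc : Continuous (fun p : X.smooth ε' => thickenSmooth ε ε' X (p, t)) :=
    (thickenSmooth ε ε' X).continuous_toFun.comp (continuous_id.prodMk continuous_const)
  have hf : ∀ p : X.smooth ε', (X.smooth (ε + ε')).f (thickenSmooth ε ε' X (p, t))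
      = (X.smooth ε').f p + t := fun p => (thickenSmooth ε ε' X).f_toFun (p, t)
  refine ⟨thickenSmooth ε ε' X (y, t), γ.map hc, fun r s hrs => ?_, ?_⟩
  · change (X.smooth (ε + ε')).f (thickenSmooth ε ε' X (γ r, t))
      ≤ (X.smooth (ε + ε')).f (thickenSmooth ε ε' X (γ s, t))
    rw [hf, hf]
    exact add_le_add_left (h1 hrs) _
  · rw [hf, hf, h2]; ring

theorem hasDownPath_thickenSmooth {ε ε' τ : ℝ≥0} {X : ScalarField.{u}} (p : X.smooth ε')
    (t : Set.Icc (-(ε : ℝ)) ε) (h : (X.smooth ε').HasDownPath τ p) :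
    (X.smooth (ε + ε')).HasDownPath τ (thickenSmooth ε ε' X (p, t)) := by
  obtain ⟨y, γ, h1, h2⟩ := h
  have hc : Continuous (fun p : X.smooth ε' => thickenSmooth ε ε' X (p, t)) :=
    (thickenSmooth ε ε' X).continuous_toFun.comp (continuous_id.prodMk continuous_const)
  have hf : ∀ p : X.smooth ε', (X.smooth (ε + ε')).f (thickenSmooth ε ε' X (p, t))
      = (X.smooth ε').f p + t := fun p => (thickenSmooth ε ε' X).f_toFun (p, t)
  refine ⟨thickenSmooth ε ε' X (y, t), γ.map hc, fun r s hrs => ?_, ?_⟩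
  · change (X.smooth (ε + ε')).f (thickenSmooth ε ε' X (γ s, t))
      ≤ (X.smooth (ε + ε')).f (thickenSmooth ε ε' X (γ r, t))
    rw [hf, hf]
    exact add_le_add_left (h1 hrs) _
  · rw [hf, hf, h2]; ring

/-- The canonical map `S_ε^τ(S_ε'^τ'(X)) → S_{ε + ε'}^{τ + τ'}(X)`,
`[[x, s], t] ↦ [x, s + t]`. -/
def truncSmoothTruncSmooth (ε τ ε' τ' : ℝ≥0) (X : ScalarField.{u}) :
    Hom ((X.truncSmooth ε' τ').truncSmooth ε τ) (X.truncSmooth (ε + ε') (τ + τ')) :=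
  let Φ : Hom ((X.truncSmooth ε' τ').smooth ε) (X.smooth (ε + ε')) :=
    (smoothSmooth ε ε' X).comp (smoothMap ε ((X.smooth ε').truncateIncl τ'))
  (Φ.comp (((X.truncSmooth ε' τ').smooth ε).truncateIncl τ)).codTruncate (τ + τ') (by
    rintro ⟨p, hp, hp'⟩
    exact ⟨hp.map_append Φ (smooth_ind fun x t => hasUpPath_thickenSmooth x.1 t x.2.1),
      hp'.map_append Φ (smooth_ind fun x t => hasDownPath_thickenSmooth x.1 t x.2.2)⟩)

/-- For `φ : X → S_ε^τ(Y)`, the map `S_ε^τ[φ] : S_ε^τ(X) → S_ε^τ(S_ε^τ(Y)) = S_{2ε}^{2τ}(Y)`,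
`[x, t] ↦ [y, s + t]` where `φ x = [y, s]`. -/
def truncSmoothMap₂ {ε τ : ℝ≥0} {X Y : ScalarField.{u}} (φ : Hom X (Y.truncSmooth ε τ)) :
    Hom (X.truncSmooth ε τ) (Y.truncSmooth (ε + ε) (τ + τ)) :=
  (truncSmoothTruncSmooth ε τ ε τ Y).comp (truncSmoothMap ε τ φ)

/-! ### The truncated interleaving distance -/

theorem toNNReal_mul_le (m : I) (ε : ℝ≥0) : unitInterval.toNNReal m * ε ≤ ε :=
  mul_le_of_le_one_left zero_le m.2.2

/-- `η : X → S_ε^{mε}(X)`. -/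
def etaFst (m : I) (ε : ℝ≥0) (X : ScalarField.{u}) :
    Hom X (X.truncSmooth ε (unitInterval.toNNReal m * ε)) :=
  eta₀ (toNNReal_mul_le m ε) X

/-- `η : S_ε^{mε}(X) → S_{2ε}^{2mε}(X)`. -/
def etaSnd (m : I) (ε : ℝ≥0) (X : ScalarField.{u}) :
    Hom (X.truncSmooth ε (unitInterval.toNNReal m * ε))
      (X.truncSmooth (ε + ε) (unitInterval.toNNReal m * ε + unitInterval.toNNReal m * ε)) :=
  eta le_self_add (by
    rw [add_assoc]
    gcongr
    exact toNNReal_mul_le m ε) X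

/-- `X` and `Y` are `ε`-interleaved using `S_ε^{mε}`: there are function preserving maps
`φ : X → S_ε^{mε}(Y)` and `ψ : Y → S_ε^{mε}(X)` such that the interleaving diagram commutes
(two triangles, and two parallelograms). -/
def IsInterleaved (m : I) (ε : ℝ≥0) (X Y : ScalarField.{u}) : Prop :=
  ∃ (φ : Hom X (Y.truncSmooth ε (unitInterval.toNNReal m * ε)))
    (ψ : Hom Y (X.truncSmooth ε (unitInterval.toNNReal m * ε))),
    (truncSmoothMap₂ ψ).comp φ = (etaSnd m ε X).comp (etaFst m ε X) ∧
    (truncSmoothMap₂ φ).comp ψ = (etaSnd m ε Y).comp (etaFst m ε Y) ∧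
    (truncSmoothMap₂ φ).comp (etaFst m ε X) = (etaSnd m ε Y).comp φ ∧
    (truncSmoothMap₂ ψ).comp (etaFst m ε Y) = (etaSnd m ε X).comp ψ

/-- The truncated interleaving distance `d_I^m`, with value `∞` if there is no interleaving. -/
noncomputable def truncInterleavingDist (m : I) (X Y : ScalarField.{u}) : ℝ≥0∞ :=
  ⨅ (ε : ℝ≥0) (_ : IsInterleaved m ε X Y), (ε : ℝ≥0∞)

/-- The truncated interleaving distance `d_I^m(R_f, R_g)` between the Reeb graphs of two scalar
fields. -/
noncomputable def reebTruncDist (m : I) (X Y : ScalarField.{u}) : ℝ≥0∞ :=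
  truncInterleavingDist m X.reeb Y.reeb

end ScalarField

/-- Two `[0, ∞]`-valued distances are strongly equivalent if each is bounded by a positive
constant times the other, uniformly in the points. -/
def StronglyEquivalent {α : Type*} (d d' : α → α → ℝ≥0∞) : Prop :=
  ∃ a b : ℝ≥0, 0 < a ∧ 0 < b ∧ ∀ x y, a * d x y ≤ d' x y ∧ d' x y ≤ b * d x y

/-! Truncation only passes to a subspace. An interleaving for `S_ε^{mε}` is therefore an
interleaving for the plain smoothing `S_ε` whose two maps land on points with up- and down-paths of
height `mε`. Equations between maps can be tested in the untruncated smoothing, where both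
parallelograms hold by naturality of `η`; this is `isInterleaved_iff`. Only the height of paths at
image points then depends on `m`.

Lower bound: paths of height `m'ε` can be cut down to height `mε`, so the same pair of maps serves
for the smaller parameter (`IsInterleaved.anti`).

Upper bound: composing with `S_ε → S_ε'` preserves the two triangles and lengthens every path by `ε'
- ε`, because the endpoint `[x, t]` can slide that far in the `t`-direction
(`IsInterleaved.enlarge`). Heights `mε + (ε' - ε) ≥ m'ε'` are needed, that is `(1 - m')ε' ≥ (1 -
m)ε`, and `ε' = (1 - m)/(1 - m') · ε` gives equality.

The argument works for arbitrary scalar fields and is applied to Reeb graphs only at the end. -/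

namespace ScalarField

/-- Function preserving maps into a truncation are equal if they are equal as maps into the ambient
scalar field. -/
theorem hom_truncate_ext {X Y : ScalarField.{u}} {τ : ℝ≥0} {φ ψ : Hom X (Y.truncate τ)} :
    φ = ψ ↔ ∀ x, (φ x).1 = (ψ x).1 :=
  ⟨fun h x => by rw [h], fun h => Hom.ext (funext fun x => Subtype.ext (h x))⟩

/-- An up-path can be cut off at any smaller height. -/
theorem HasUpPath.mono {X : ScalarField.{u}} {ρ τ : ℝ≥0} (hρ : ρ ≤ τ) {x : X}
    (h : X.HasUpPath τ x) : X.HasUpPath ρ x := by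
  obtain ⟨y, γ, hγ, hy⟩ := h
  have hc : Continuous fun t => X.f (γ t) := X.continuous_f.comp γ.continuous
  -- The intermediate value theorem gives a time `s` at which `f` has risen by exactly `ρ`; the
  -- initial segment of `γ` up to `s`, rescaled to the unit interval, is the required path.
  obtain ⟨s, hs⟩ : X.f x + ρ ∈ Set.range fun t => X.f (γ t) := by
    refine mem_range_of_exists_le_of_exists_ge hc ⟨0, ?_⟩ ⟨1, ?_⟩
    · simp
    · have : (ρ : ℝ) ≤ τ := hρ
      simp [hy, this]
  refine ⟨γ s, ⟨⟨fun r => γ (s * r), by fun_prop⟩, by simp, by simp⟩, fun a b hab => ?_, hs⟩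
  exact hγ (mul_le_mul_right hab s)

theorem HasDownPath.mono {X : ScalarField.{u}} {ρ τ : ℝ≥0} (hρ : ρ ≤ τ) {x : X}
    (h : X.HasDownPath τ x) : X.HasDownPath ρ x := by
  obtain ⟨y, γ, hγ, hy⟩ := h
  have hc : Continuous fun t => X.f (γ t) := X.continuous_f.comp γ.continuous
  obtain ⟨s, hs⟩ : X.f x - ρ ∈ Set.range fun t => X.f (γ t) := by
    refine mem_range_of_exists_le_of_exists_ge hc ⟨1, ?_⟩ ⟨0, ?_⟩
    · have : (ρ : ℝ) ≤ τ := hρ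
      simp only [Path.target, hy]
      linarith
    · simp
  refine ⟨γ s, ⟨⟨fun r => γ (s * r), by fun_prop⟩, by simp, by simp⟩, fun a b hab => ?_, hs⟩
  exact hγ (mul_le_mul_right hab s)

/-! ### Reduction to untruncated smoothings -/

/-- For `φ : X → S_ε(Y)`, the map `S_ε(X) → S_ε(S_ε(Y)) → S_{2ε}(Y)`. -/
def smoothMap₂ {ε : ℝ≥0} {X Y : ScalarField.{u}} (φ : Hom X (Y.smooth ε)) :
    Hom (X.smooth ε) (Y.smooth (ε + ε)) :=
  (smoothSmooth ε ε Y).comp (smoothMap ε φ)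

/-- This lets the interleaving diagrams be checked after the injective inclusion of the truncation,
without carrying path data. -/
theorem coe_truncSmoothMap₂ {ε τ : ℝ≥0} {X Y : ScalarField.{u}}
    (φ : Hom X (Y.truncSmooth ε τ)) (p : X.truncSmooth ε τ) :
    (truncSmoothMap₂ φ p).1 = smoothMap₂ (((Y.smooth ε).truncateIncl τ).comp φ) p.1 := by
  obtain ⟨p, hp⟩ := p
  induction p using smooth_ind with | h x t
  rfl

theorem smoothMap₂_toSmooth {ε : ℝ≥0} {X Y : ScalarField.{u}} (φ : Hom X (Y.smooth ε)) (x : X) :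
    smoothMap₂ φ (X.toSmooth ε x) = Y.smoothIncl le_self_add (φ x) := by
  change thickenSmooth ε ε Y (φ x, ⟨0, _⟩) = _
  -- Once `φ x` is an arbitrary point it may be written as a class `[y, s]`, and the claim becomes
  -- `s + 0 = s`.
  generalize φ x = p
  induction p using smooth_ind with | h y s
  refine congrArg (Y.smoothMk (ε + ε)) (Prod.ext rfl (Subtype.ext ?_))
  exact add_zero (s : ℝ)

/-- When `φ x = [y, s]`, both sides send `[x, t]` to `[y, s + t]`; enlarging the smoothing parameter
does not change representatives. -/
theorem smoothMap₂_smoothIncl {ε ε' : ℝ≥0} (h : ε ≤ ε') {X Y : ScalarField.{u}}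
    (φ : Hom X (Y.smooth ε)) (p : X.smooth ε) :
    smoothMap₂ ((Y.smoothIncl h).comp φ) (X.smoothIncl h p) =
      Y.smoothIncl (add_le_add h h) (smoothMap₂ φ p) := by
  induction p using smooth_ind with | h x t
  change thickenSmooth ε' ε' Y (Y.smoothIncl h (φ x), ⟨t, _⟩) =
    Y.smoothIncl (add_le_add h h) (thickenSmooth ε ε Y (φ x, t))
  generalize φ x = q
  induction q using smooth_ind with | h y s
  rfl

/-- Interleavings with respect to `S_ε^{mε}` are interleavings with respect to `S_ε` whose maps take
values in the truncations; the two parallelograms commute automatically. -/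
theorem isInterleaved_iff {m : I} {ε : ℝ≥0} {X Y : ScalarField.{u}} :
    IsInterleaved m ε X Y ↔ ∃ (φ : Hom X (Y.smooth ε)) (ψ : Hom Y (X.smooth ε)),
      (∀ x, (Y.smooth ε).HasUpPath (unitInterval.toNNReal m * ε) (φ x) ∧
        (Y.smooth ε).HasDownPath (unitInterval.toNNReal m * ε) (φ x)) ∧
      (∀ y, (X.smooth ε).HasUpPath (unitInterval.toNNReal m * ε) (ψ y) ∧
        (X.smooth ε).HasDownPath (unitInterval.toNNReal m * ε) (ψ y)) ∧
      (∀ x, smoothMap₂ ψ (φ x) = X.toSmooth (ε + ε) x) ∧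
      (∀ y, smoothMap₂ φ (ψ y) = Y.toSmooth (ε + ε) y) := by
  constructor
  · rintro ⟨φ, ψ, h₁, h₂, -, -⟩
    refine ⟨(truncateIncl _ _).comp φ, (truncateIncl _ _).comp ψ, fun x => (φ x).2,
      fun y => (ψ y).2, fun x => ?_, fun y => ?_⟩
    · exact (coe_truncSmoothMap₂ ψ (φ x)).symm.trans (hom_truncate_ext.1 h₁ x)
    · exact (coe_truncSmoothMap₂ φ (ψ y)).symm.trans (hom_truncate_ext.1 h₂ y)
  · rintro ⟨φ, ψ, hφ, hψ, h₁, h₂⟩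
    refine ⟨φ.codTruncate _ hφ, ψ.codTruncate _ hψ, hom_truncate_ext.2 fun x => ?_,
      hom_truncate_ext.2 fun y => ?_, hom_truncate_ext.2 fun x => ?_,
      hom_truncate_ext.2 fun y => ?_⟩
    · exact (coe_truncSmoothMap₂ (ψ.codTruncate _ hψ) (φ.codTruncate _ hφ x)).trans (h₁ x)
    · exact (coe_truncSmoothMap₂ (φ.codTruncate _ hφ) (ψ.codTruncate _ hψ y)).trans (h₂ y)
    -- The parallelograms use neither triangle: shifting `φ x` by `0` is just its image in the
    -- larger smoothing.
    · exact (coe_truncSmoothMap₂ (φ.codTruncate _ hφ) (etaFst m ε X x)).trans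
        (smoothMap₂_toSmooth φ x)
    · exact (coe_truncSmoothMap₂ (ψ.codTruncate _ hψ) (etaFst m ε Y y)).trans
        (smoothMap₂_toSmooth ψ y)

/-! ### Changing the parameters of an interleaving -/

theorem IsInterleaved.anti {m m' : I} (h : m ≤ m') {ε : ℝ≥0} {X Y : ScalarField.{u}}
    (hXY : IsInterleaved m' ε X Y) : IsInterleaved m ε X Y := by
  obtain ⟨φ, ψ, hφ, hψ, h₁, h₂⟩ := isInterleaved_iff.1 hXY
  have hm : unitInterval.toNNReal m * ε ≤ unitInterval.toNNReal m' * ε :=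
    mul_le_mul_left (show unitInterval.toNNReal m ≤ unitInterval.toNNReal m' from h) ε
  exact isInterleaved_iff.2 ⟨φ, ψ, fun x => ⟨(hφ x).1.mono hm, (hφ x).2.mono hm⟩,
    fun y => ⟨(hψ y).1.mono hm, (hψ y).2.mono hm⟩, h₁, h₂⟩

/-- Composing the maps of an interleaving with `η : S_ε^{mε} → S_ε'^{m'ε'}` gives an
interleaving. -/
theorem IsInterleaved.enlarge {m m' : I} {ε ε' : ℝ≥0} {X Y : ScalarField.{u}}
    (hXY : IsInterleaved m ε X Y)
    (hτ : unitInterval.toNNReal m * ε ≤ unitInterval.toNNReal m' * ε')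
    (h : ε + unitInterval.toNNReal m' * ε' ≤ ε' + unitInterval.toNNReal m * ε) :
    IsInterleaved m' ε' X Y := by
  -- Add `ε` to `hτ`, chain with `h`, and cancel `mε`.
  have hε : ε ≤ ε' := le_of_add_le_add_right ((add_le_add_right hτ ε).trans h)
  obtain ⟨φ, ψ, hφ, hψ, h₁, h₂⟩ := isInterleaved_iff.1 hXY
  refine isInterleaved_iff.2 ⟨(Y.smoothIncl hε).comp φ, (X.smoothIncl hε).comp ψ,
    -- The underlying point of `eta` at `φ x` is its image under `smoothIncl`, so the membership
    -- proof carried by `eta` supplies the longer paths.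
    fun x => (eta hτ h Y ⟨φ x, hφ x⟩).2, fun y => (eta hτ h X ⟨ψ y, hψ y⟩).2,
    fun x => ?_, fun y => ?_⟩
  · refine (smoothMap₂_smoothIncl hε ψ (φ x)).trans ?_
    rw [h₁]
    rfl
  · refine (smoothMap₂_smoothIncl hε φ (ψ y)).trans ?_
    rw [h₂]
    rfl

/-! ### Comparison of the distances -/

theorem truncInterleavingDist_mono {m m' : I} (h : m ≤ m') (X Y : ScalarField.{u}) :
    truncInterleavingDist m X Y ≤ truncInterleavingDist m' X Y :=
  le_iInf₂ fun ε hε => iInf₂_le ε (hε.anti h)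

theorem truncInterleavingDist_le_mul {m m' : I} (h : m ≤ m') (h' : m' < 1)
    (X Y : ScalarField.{u}) :
    truncInterleavingDist m' X Y ≤
      ENNReal.ofReal ((1 - (m : ℝ)) / (1 - (m' : ℝ))) * truncInterleavingDist m X Y := by
  have hm : (m : ℝ) ≤ m' := h
  have hm' : 0 < 1 - (m' : ℝ) := sub_pos.2 h'
  have hc : 0 < (1 - (m : ℝ)) / (1 - (m' : ℝ)) := div_pos (by linarith) hm'
  have hc1 : 1 ≤ (1 - (m : ℝ)) / (1 - (m' : ℝ)) := (one_le_div hm').2 (by linarith)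
  have hcm : (1 - (m : ℝ)) / (1 - (m' : ℝ)) * (1 - m') = 1 - m := div_mul_cancel₀ _ hm'.ne'
  set c : ℝ := (1 - (m : ℝ)) / (1 - (m' : ℝ))
  have hc0 : ENNReal.ofReal c ≠ 0 := (ENNReal.ofReal_pos.2 hc).ne'
  unfold truncInterleavingDist
  -- As `c` is neither `0` nor `∞`, it moves inside both infima, including empty ones, where `c * ∞
  -- = ∞`. It remains to rescale a single interleaving from `ε` to `c * ε`.
  rw [ENNReal.mul_iInf_of_ne hc0 ENNReal.ofReal_ne_top]
  refine le_iInf fun ε => ?_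
  rw [ENNReal.mul_iInf_of_ne hc0 ENNReal.ofReal_ne_top]
  refine le_iInf fun hε => ?_
  change _ ≤ ((c.toNNReal : ℝ≥0) : ℝ≥0∞) * ε
  rw [← ENNReal.coe_mul]
  refine iInf₂_le (c.toNNReal * ε) (hε.enlarge ?_ ?_)
  · rw [← NNReal.coe_le_coe]
    push_cast [Real.coe_toNNReal c hc.le]
    change (m : ℝ) * ε ≤ m' * (c * ε)
    have h1 : (ε : ℝ) ≤ c * ε := le_mul_of_one_le_left ε.2 hc1
    exact mul_le_mul hm h1 ε.2 m'.2.1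
  · rw [← NNReal.coe_le_coe]
    push_cast [Real.coe_toNNReal c hc.le]
    change (ε : ℝ) + m' * (c * ε) ≤ c * ε + m * ε
    -- Both sides agree, since `c(1 - m') = 1 - m`; this identity dictates the choice of `c`.
    linear_combination -(ε : ℝ) * hcm

end ScalarField

theorem mainTheorem5 (M M' : unitInterval) (hM : M ≤ M') (hM' : M' < 1) :
    StronglyEquivalent (ScalarField.reebTruncDist.{u} M) (ScalarField.reebTruncDist.{u} M') ∧
    ∀ X Y : ScalarField.{u},
      ScalarField.reebTruncDist M X Y ≤ ScalarField.reebTruncDist M' X Y ∧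
      ScalarField.reebTruncDist M' X Y ≤
        ENNReal.ofReal ((1 - (M : ℝ)) / (1 - (M' : ℝ))) * ScalarField.reebTruncDist M X Y := by
  have key : ∀ X Y : ScalarField.{u},
      ScalarField.reebTruncDist M X Y ≤ ScalarField.reebTruncDist M' X Y ∧
      ScalarField.reebTruncDist M' X Y ≤
        ENNReal.ofReal ((1 - (M : ℝ)) / (1 - (M' : ℝ))) * ScalarField.reebTruncDist M X Y :=
    fun X Y => ⟨ScalarField.truncInterleavingDist_mono hM X.reeb Y.reeb,
      ScalarField.truncInterleavingDist_le_mul hM hM' X.reeb Y.reeb⟩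
  have hpos : 0 < (1 - (M : ℝ)) / (1 - (M' : ℝ)) :=
    div_pos (sub_pos.2 (hM.trans_lt hM')) (sub_pos.2 hM')
  refine ⟨⟨1, Real.toNNReal ((1 - (M : ℝ)) / (1 - (M' : ℝ))), one_pos, Real.toNNReal_pos.2 hpos,
    fun X Y => ⟨?_, (key X Y).2⟩⟩, key⟩
  rw [ENNReal.coe_one, one_mul]
  exact (key X Y).1
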